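/- Fix an algebraic language; algebras have nonempty carriers. A quasi-identity is a sentence $q=(\forall\bar x)\,[\varphi(\bar x)\to\psi(\bar x)]$, where $\varphi$ is a finite, possibly empty, conjunction of equations between terms and $\psi$ is an equation; put $q^*=(\forall\bar x)\,[\neg\varphi(\bar x)]$. A quasivariety is a class of algebras defined by a set of quasi-identities, and $\mathsf Q(\mathbf B)$ denotes the quasivariety generated by an algebra $\mathbf B$, that is, the class of all algebras satisfying every quasi-identity true in $\mathbf B$. For a quasivariety $\mathcal Q$, let $\mathbf F_{\mathcal Q}$ be its free algebra over a countably infinite set $V$ of variables, i.e. the algebra of terms over $V$ divided by the congruence which identifies terms $s,t$ whenever the identity $s\approx t$ holds in $\mathcal Q$. A quasi-identity $q$ is $\mathcal Q$-active if $q$ is true in $\mathbf F_{\mathcal Q}$ and $q^*$ is not true in $\mathbf F_{\mathcal Q}$. The quasivariety $\mathcal Q$ is almost structurally complete (ASC) if every $\mathcal Q$-active quasi-identity holds in $\mathcal Q$. The ASC core $\mathsf{ASCC}(\mathcal Q)$ is the class of those algebras in $\mathcal Q$ that satisfy all $\mathcal Q$-active quasi-identities. **Proposition 4.1.** Let $\mathcal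 Q$ be a quasivariety (for instance, a variety) and $\mathbf F=\mathbf F_{\mathcal Q}$. For every subalgebra $\mathbf C$ of $\mathbf F$ we have $$\mathsf{ASCC}(\mathcal Q)=\{\mathbf A\in\mathcal Q\mid \mathbf A\times\mathbf C\in\mathsf Q(\mathbf F)\}.$$ Moreover, a quasivariety $\mathcal R$ with $\mathsf Q(\mathbf F)\subseteq\mathcal R\subseteq\mathcal Q$ is ASC if and only if $\mathcal R\subseteq\mathsf{ASCC}(\mathcal Q)$. -/

import Mathlib

open FirstOrder.Language

universe u v w w'

/-- A (universal) algebra in the algebraic language `L`: a nonempty set with an interpretation of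
the operation symbols of `L`.  As usual in universal algebra, carriers are nonempty. -/
structure Alg (L : FirstOrder.Language.{u, v}) where
  /-- the carrier of the algebra -/
  carrier : Type w
  [str : L.Structure carrier]
  [nonempty : Nonempty carrier]

attribute [instance] Alg.str Alg.nonempty

/-- A quasi-identity `(∀ x̄) [s₁ ≈ t₁ ∧ ⋯ ∧ sₙ ≈ tₙ → s ≈ t]`, with terms in the variables
`v₀, v₁, v₂, …`; the list of premises may be empty. (Only finitely many variables occur, and
carriers are nonempty, so quantifying over the values of all the variables `vᵢ` is the same as
quantifying over those which occur.) -/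
structure QuasiIdentity (L : FirstOrder.Language.{u, v}) where
  /-- the equations `sᵢ ≈ tᵢ` of the premise -/
  premise : List (L.Term ℕ × L.Term ℕ)
  /-- the equation `s ≈ t` of the conclusion -/
  conclusion : L.Term ℕ × L.Term ℕ

namespace Alg

variable {L : FirstOrder.Language.{u, v}}

/-- The equation `e.1 ≈ e.2` holds in `A` under the assignment `x` of the variables. -/
def SatEq (A : Alg.{u, v, w} L) (x : ℕ → A.carrier) (e : L.Term ℕ × L.Term ℕ) : Prop :=
  e.1.realize x = e.2.realize x

/-- The premise of `q` holds in `A` under the assignment `x` of the variables. -/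
def SatPremise (A : Alg.{u, v, w} L) (x : ℕ → A.carrier) (q : QuasiIdentity L) : Prop :=
  ∀ e ∈ q.premise, A.SatEq x e

/-- The quasi-identity `q` is true in `A`. -/
def Models (A : Alg.{u, v, w} L) (q : QuasiIdentity L) : Prop :=
  ∀ x : ℕ → A.carrier, A.SatPremise x q → A.SatEq x q.conclusion

/-- `q* = (∀ x̄) [¬ φ(x̄)]` is true in `A`, where `φ` is the premise of `q`. -/
def ModelsStar (A : Alg.{u, v, w} L) (q : QuasiIdentity L) : Prop :=
  ∀ x : ℕ → A.carrier, ¬ A.SatPremise x q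

/-- The direct product `A × B`, with componentwise operations. -/
def prod (A : Alg.{u, v, w} L) (B : Alg.{u, v, w'} L) : Alg.{u, v, max w w'} L where
  carrier := A.carrier × B.carrier
  str :=
    { funMap := fun f x =>
        (Structure.funMap f fun i => (x i).1, Structure.funMap f fun i => (x i).2)
      RelMap := fun r x =>
        Structure.RelMap r (fun i => (x i).1) ∧ Structure.RelMap r (fun i => (x i).2) }

/-- A nonempty subset closed under the operations, viewed as an algebra. -/
def ofSubalgebra (A : Alg.{u, v, w} L) (C : L.Substructure A.carrier) (hC : Nonempty C) :
    Alg.{u, v, w} L where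
  carrier := C

/-- `Q(B)`: the class of all algebras satisfying the quasi-equational theory of `B`, that is, the
smallest quasivariety containing `B`. -/
def quasivarietyGenerated (B : Alg.{u, v, w} L) : Set (Alg.{u, v, w'} L) :=
  {A | ∀ q : QuasiIdentity L, B.Models q → A.Models q}

end Alg

section Quasivarieties

variable {L : FirstOrder.Language.{u, v}}

/-- A quasivariety: a class of algebras defined by a set of quasi-identities. -/
def IsQuasivariety (Q : Set (Alg.{u, v, w} L)) : Prop :=
  ∃ S : Set (QuasiIdentity L), Q = {A | ∀ q ∈ S, A.Models q}

/-- The relation on terms over `V = {v₀, v₁, …}` which identifies `s` and `t` when they determine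
the same term operation on every algebra from `Q`. -/
def freeSetoid (Q : Set (Alg.{u, v, w} L)) : Setoid (L.Term ℕ) where
  r s t := ∀ A ∈ Q, ∀ x : ℕ → A.carrier, s.realize x = t.realize x
  iseqv :=
    { refl := fun _ _ _ _ => rfl
      symm := fun h A hA x => (h A hA x).symm
      trans := fun h k A hA x => (h A hA x).trans (k A hA x) }

/-- The term algebra over `V = {v₀, v₁, …}`, and `freeSetoid Q` as a congruence on it. (Relation
symbols, of which an algebraic language has none, are interpreted as empty.) -/
instance freePrestructure (Q : Set (Alg.{u, v, w} L)) : L.Prestructure (freeSetoid Q) where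
  toStructure :=
    { funMap := fun f ts => Term.func f ts
      RelMap := fun _ _ => False }
  fun_equiv := fun {_ f} _ _ h A hA x =>
    congrArg (Structure.funMap f) (funext fun i => h i A hA x)
  rel_equiv := fun _ _ _ => rfl

/-- `F`: the free algebra for `Q` over `V = {v₀, v₁, v₂, …}`. -/
def freeAlg (Q : Set (Alg.{u, v, w} L)) : Alg.{u, v, u} L where
  carrier := Quotient (freeSetoid Q)
  nonempty := ⟨Quotient.mk _ (Term.var 0)⟩

/-- `q` is `Q`-active: it is true in the free algebra `F` for `Q`, while `q*` is not. -/
def IsActive (Q : Set (Alg.{u, v, w} L)) (q : QuasiIdentity L) : Prop :=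
  (freeAlg Q).Models q ∧ ¬ (freeAlg Q).ModelsStar q

/-- `Q` is almost structurally complete: all `Q`-active quasi-identities hold in `Q`. -/
def IsASC (Q : Set (Alg.{u, v, w} L)) : Prop :=
  ∀ q : QuasiIdentity L, IsActive Q q → ∀ A ∈ Q, A.Models q

/-- The ASC core of `Q`: the class defined relative to `Q` by all `Q`-active quasi-identities. -/
def ASCC (Q : Set (Alg.{u, v, w} L)) : Set (Alg.{u, v, w} L) :=
  {A | A ∈ Q ∧ ∀ q : QuasiIdentity L, IsActive Q q → A.Models q}

end Quasivarieties

namespace Alg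

variable {L : FirstOrder.Language.{u, v}}

/-! Let `q` be true in F. If `q*` is true in F, it is true in the subalgebra C, and `q` holds
vacuously in A × C. Otherwise `q` is active, and its premise is solvable in C: a solution in F is a
family of terms, which can be evaluated at any element of C. Pairing a solution in A with one in C
shows that A satisfies `q` once A × C does; conversely, `q` passes from F to C and from A and C to A
× C. For the second claim, activity depends only on the identities of the class, and `R` has the
same identities as `Q`, hence the same active quasi-identities. -/

theorem realize_prod (A : Alg.{u, v, w} L) (B : Alg.{u, v, w'} L) (t : L.Term ℕ)
    (x : ℕ → (A.prod B).carrier) :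
    t.realize x =
      ((t.realize fun i => (x i).1, t.realize fun i => (x i).2) : A.carrier × B.carrier) := by
  induction t with
  | var i => rfl
  | func f ts ih =>
    simp only [Term.realize_func, ih]
    rfl

theorem satEq_prod (A : Alg.{u, v, w} L) (B : Alg.{u, v, w'} L) (x : ℕ → (A.prod B).carrier)
    (e : L.Term ℕ × L.Term ℕ) :
    (A.prod B).SatEq x e ↔ A.SatEq (fun i => (x i).1) e ∧ B.SatEq (fun i => (x i).2) e := by
  unfold SatEq
  rw [realize_prod, realize_prod]
  exact Prod.ext_iff

/-- The inclusion of a subalgebra. -/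
def ofSubalgebraVal (A : Alg.{u, v, w} L) (C : L.Substructure A.carrier) (hC : Nonempty C)
    (x : (A.ofSubalgebra C hC).carrier) : A.carrier :=
  Subtype.val (p := (· ∈ C)) x

theorem ofSubalgebraVal_injective (A : Alg.{u, v, w} L) (C : L.Substructure A.carrier)
    (hC : Nonempty C) : Function.Injective (A.ofSubalgebraVal C hC) :=
  Subtype.val_injective

theorem realize_ofSubalgebra (A : Alg.{u, v, w} L) (C : L.Substructure A.carrier)
    (hC : Nonempty C) (t : L.Term ℕ) (x : ℕ → (A.ofSubalgebra C hC).carrier) :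
    A.ofSubalgebraVal C hC (t.realize x) =
      t.realize fun i => A.ofSubalgebraVal C hC (x i) := by
  induction t with
  | var i => rfl
  | func f ts ih =>
    simp only [Term.realize_func, ← ih]
    rfl

theorem satEq_ofSubalgebra (A : Alg.{u, v, w} L) (C : L.Substructure A.carrier)
    (hC : Nonempty C) (x : ℕ → (A.ofSubalgebra C hC).carrier) (e : L.Term ℕ × L.Term ℕ) :
    (A.ofSubalgebra C hC).SatEq x e ↔ A.SatEq (fun i => A.ofSubalgebraVal C hC (x i)) e := by
  unfold SatEq
  rw [← realize_ofSubalgebra A C hC, ← realize_ofSubalgebra A C hC]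
  exact (A.ofSubalgebraVal_injective C hC).eq_iff.symm

theorem Models.prod {A : Alg.{u, v, w} L} {B : Alg.{u, v, w'} L} {q : QuasiIdentity L}
    (hA : A.Models q) (hB : B.Models q) : (A.prod B).Models q := fun x hx =>
  (satEq_prod A B x _).2
    ⟨hA _ fun e he => ((satEq_prod A B x e).1 (hx e he)).1,
      hB _ fun e he => ((satEq_prod A B x e).1 (hx e he)).2⟩

theorem Models.ofSubalgebra {A : Alg.{u, v, w} L} {q : QuasiIdentity L} (hA : A.Models q)
    (C : L.Substructure A.carrier) (hC : Nonempty C) : (A.ofSubalgebra C hC).Models q :=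
  fun x hx => (satEq_ofSubalgebra A C hC x _).2
    (hA _ fun e he => (satEq_ofSubalgebra A C hC x e).1 (hx e he))

/-- If `q*` holds in `B` then it holds, and so does `q`, in `A × C` for subalgebras `C` of `B`. -/
theorem ModelsStar.models_prod_ofSubalgebra {B : Alg.{u, v, w} L} {q : QuasiIdentity L}
    (hB : B.ModelsStar q) (A : Alg.{u, v, w'} L) (C : L.Substructure B.carrier)
    (hC : Nonempty C) : (A.prod (B.ofSubalgebra C hC)).Models q := fun x hx =>
  (hB _ fun e he =>
    (satEq_ofSubalgebra B C hC _ e).1 ((satEq_prod A _ x e).1 (hx e he)).2).elim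

/-- A copy of an algebra in a higher universe. -/
def lift (A : Alg.{u, v, w} L) : Alg.{u, v, max w w'} L where
  carrier := ULift.{w'} A.carrier
  str :=
    { funMap := fun f x => ⟨Structure.funMap f fun i => (x i).down⟩
      RelMap := fun r x => Structure.RelMap r fun i => (x i).down }

theorem realize_lift (A : Alg.{u, v, w} L) (t : L.Term ℕ)
    (x : ℕ → ULift.{w'} A.carrier) :
    (Term.realize (M := (lift.{u, v, w, w'} A).carrier) x t : ULift.{w'} A.carrier) =
      ⟨t.realize fun i => (x i).down⟩ := by
  induction t with
  | var i => rfl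
  | func f ts ih => exact congrArg (Structure.funMap (M := (lift A).carrier) f) (funext ih)

theorem satEq_lift (A : Alg.{u, v, w} L) (x : ℕ → ULift.{w'} A.carrier)
    (e : L.Term ℕ × L.Term ℕ) :
    (lift.{u, v, w, w'} A).SatEq x e ↔ A.SatEq (fun i => (x i).down) e := by
  unfold SatEq
  rw [realize_lift, realize_lift]
  exact ULift.ext_iff

/-- Lets F count as a member of Q(F) when the class lives in a larger universe than F. -/
theorem lift_mem_quasivarietyGenerated (A : Alg.{u, v, w} L) :
    lift.{u, v, w, w'} A ∈ A.quasivarietyGenerated := fun _ hq x hx =>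
  (satEq_lift A x _).2 (hq _ fun e he => (satEq_lift A x e).1 (hx e he))

end Alg

section FreeAlgebra

variable {L : FirstOrder.Language.{u, v}}

/-- In the free algebra, term operations are given by substitution. -/
theorem realize_freeAlg (Q : Set (Alg.{u, v, w} L)) (t : L.Term ℕ) (σ : ℕ → L.Term ℕ) :
    (Term.realize (M := (freeAlg Q).carrier) (fun i => Quotient.mk (freeSetoid Q) (σ i)) t :
      Quotient (freeSetoid Q)) = Quotient.mk (freeSetoid Q) (t.subst σ) := by
  induction t with
  | var i => rfl
  | func f ts ih =>
    exact (congrArg (Structure.funMap (M := (freeAlg Q).carrier) f) (funext ih)).trans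
      (funMap_quotient_mk' (s := freeSetoid Q) f fun i => (ts i).subst σ)

theorem satEq_freeAlg (Q : Set (Alg.{u, v, w} L)) (σ : ℕ → L.Term ℕ)
    (e : L.Term ℕ × L.Term ℕ) :
    (freeAlg Q).SatEq (fun i => Quotient.mk (freeSetoid Q) (σ i)) e ↔
      freeSetoid Q (e.1.subst σ) (e.2.subst σ) := by
  unfold Alg.SatEq
  rw [realize_freeAlg, realize_freeAlg]
  exact Quotient.eq

theorem exists_eq_mk (Q : Set (Alg.{u, v, w} L)) (x : ℕ → (freeAlg Q).carrier) :
    ∃ σ : ℕ → L.Term ℕ, x = fun i => Quotient.mk (freeSetoid Q) (σ i) := by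
  choose σ hσ using fun i => Quotient.exists_rep (x i)
  exact ⟨σ, funext fun i => (hσ i).symm⟩

/-- Assignments into F are substitutions modulo identities, so truth in F depends on `Q` only
through `freeSetoid Q`. -/
theorem models_freeAlg_iff (Q : Set (Alg.{u, v, w} L)) (q : QuasiIdentity L) :
    (freeAlg Q).Models q ↔ ∀ σ : ℕ → L.Term ℕ,
      (∀ e ∈ q.premise, freeSetoid Q (e.1.subst σ) (e.2.subst σ)) →
        freeSetoid Q (q.conclusion.1.subst σ) (q.conclusion.2.subst σ) := by
  refine ⟨fun h σ hσ => (satEq_freeAlg Q σ _).1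
    (h _ fun e he => (satEq_freeAlg Q σ e).2 (hσ e he)), fun h x hx => ?_⟩
  obtain ⟨σ, rfl⟩ := exists_eq_mk Q x
  exact (satEq_freeAlg Q σ _).2 (h σ fun e he => (satEq_freeAlg Q σ e).1 (hx e he))

theorem modelsStar_freeAlg_iff (Q : Set (Alg.{u, v, w} L)) (q : QuasiIdentity L) :
    (freeAlg Q).ModelsStar q ↔ ∀ σ : ℕ → L.Term ℕ,
      ¬ ∀ e ∈ q.premise, freeSetoid Q (e.1.subst σ) (e.2.subst σ) := by
  refine ⟨fun h σ hσ => h _ fun e he => (satEq_freeAlg Q σ e).2 (hσ e he), fun h x hx => ?_⟩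
  obtain ⟨σ, rfl⟩ := exists_eq_mk Q x
  exact h σ fun e he => (satEq_freeAlg Q σ e).1 (hx e he)

/-- The free algebra satisfies the identities of the class. -/
theorem satEq_freeAlg_of_freeSetoid {Q : Set (Alg.{u, v, w} L)} {s t : L.Term ℕ}
    (h : freeSetoid Q s t) (x : ℕ → (freeAlg Q).carrier) : (freeAlg Q).SatEq x (s, t) := by
  obtain ⟨σ, rfl⟩ := exists_eq_mk Q x
  refine (satEq_freeAlg Q σ _).2 fun A hA y => ?_
  simpa only [Term.realize_subst] using h A hA fun i => (σ i).realize y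

/-- The free algebra satisfies only the identities of the class. -/
theorem freeSetoid_of_satEq_freeAlg {Q : Set (Alg.{u, v, w} L)} {s t : L.Term ℕ}
    (h : ∀ x : ℕ → (freeAlg Q).carrier, (freeAlg Q).SatEq x (s, t)) : freeSetoid Q s t := by
  intro A hA x
  -- Under the assignment of each variable to its own class, a term evaluates to its own class.
  simpa only [Term.realize_subst, Term.realize_var] using
    (satEq_freeAlg Q Term.var _).1 (h _) A hA x

/-- A premise satisfiable in the free algebra is satisfiable in each of its subalgebras. -/
theorem exists_satPremise_ofSubalgebra {Q : Set (Alg.{u, v, w} L)} {q : QuasiIdentity L}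
    (hq : ¬ (freeAlg Q).ModelsStar q) (C : L.Substructure (freeAlg Q).carrier)
    (hC : Nonempty C) :
    ∃ x : ℕ → ((freeAlg Q).ofSubalgebra C hC).carrier,
      ((freeAlg Q).ofSubalgebra C hC).SatPremise x q := by
  rw [modelsStar_freeAlg_iff] at hq
  push Not at hq
  obtain ⟨σ, hσ⟩ := hq
  obtain ⟨c⟩ := hC
  let D := (freeAlg Q).ofSubalgebra C ⟨c⟩
  refine ⟨fun i => Term.realize (M := D.carrier) (fun _ => c) (σ i), fun e he => ?_⟩
  -- The substituted premises are identities of `Q`, so they hold in F and hence in C, in particular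
  -- at the constant assignment `c`.
  have h : D.SatEq (fun _ => c) (e.1.subst σ, e.2.subst σ) :=
    (Alg.satEq_ofSubalgebra _ C ⟨c⟩ _ _).2 (satEq_freeAlg_of_freeSetoid (hσ e he) _)
  exact (Term.realize_subst.symm.trans h).trans Term.realize_subst

theorem isActive_congr {Q R : Set (Alg.{u, v, w} L)} (h : freeSetoid R = freeSetoid Q)
    (q : QuasiIdentity L) : IsActive R q ↔ IsActive Q q := by
  have hst (s t : L.Term ℕ) : freeSetoid R s t ↔ freeSetoid Q s t := by rw [h]
  simp only [IsActive, models_freeAlg_iff, modelsStar_freeAlg_iff, hst]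

/-- Classes between `Q(F)` and `Q` satisfy the same identities as `Q`. -/
theorem freeSetoid_eq_of_subset {Q R : Set (Alg.{u, v, max u w} L)}
    (hFR : (freeAlg Q).quasivarietyGenerated ⊆ R) (hRQ : R ⊆ Q) :
    freeSetoid R = freeSetoid Q := by
  refine Setoid.ext fun s t => ⟨fun h => freeSetoid_of_satEq_freeAlg fun x => ?_,
    fun h A hA => h A (hRQ hA)⟩
  -- A copy of F lies in `R`, so every identity of `R` holds in F and is therefore an identity of
  -- `Q`.
  have hF : Alg.lift.{u, v, u, max u w} (freeAlg Q) ∈ R :=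
    hFR (Alg.lift_mem_quasivarietyGenerated _)
  exact (Alg.satEq_lift (freeAlg Q) (fun i => ⟨x i⟩) (s, t)).1 (h _ hF _)

end FreeAlgebra

theorem proposition4p1 {L : FirstOrder.Language.{u, v}} [L.IsAlgebraic]
    (Q : Set (Alg.{u, v, max u w} L)) (hQ : IsQuasivariety Q) :
    (∀ (C : L.Substructure (freeAlg Q).carrier) (hC : Nonempty C),
      ASCC Q = {A : Alg.{u, v, max u w} L | A ∈ Q ∧
        A.prod ((freeAlg Q).ofSubalgebra C hC) ∈ (freeAlg Q).quasivarietyGenerated}) ∧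
    (∀ R : Set (Alg.{u, v, max u w} L), IsQuasivariety R →
      (freeAlg Q).quasivarietyGenerated ⊆ R → R ⊆ Q → (IsASC R ↔ R ⊆ ASCC Q)) := by
  refine ⟨fun C hC => Set.ext fun A => and_congr_right fun _ => ⟨fun h q hq => ?_,
    fun h q hq x hx => ?_⟩, fun R _ hFR hRQ => ?_⟩
  · by_cases hs : (freeAlg Q).ModelsStar q
    · exact hs.models_prod_ofSubalgebra A C hC
    · exact (h q ⟨hq, hs⟩).prod (hq.ofSubalgebra C hC)
  -- The solution `c` in C makes the premise true at `(x, c)`; the first coordinate of the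
  -- conclusion is what A needs.
  · obtain ⟨c, hc⟩ := exists_satPremise_ofSubalgebra hq.2 C hC
    exact ((Alg.satEq_prod A _ _ _).1 (h q hq.1 (fun i => (x i, c i)) fun e he =>
      (Alg.satEq_prod A _ _ e).2 ⟨hx e he, hc e he⟩)).1
  · have hact := isActive_congr (freeSetoid_eq_of_subset hFR hRQ)
    exact ⟨fun h A hA => ⟨hRQ hA, fun q hq => h q ((hact q).2 hq) A hA⟩,
      fun h q hq A hA => (h hA).2 q ((hact q).1 hq)⟩
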